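/- **Theorem (higher order Chernoff inequality).** Let $\gamma$ be a $C^\infty$ regular simple closed curve in $\mathbb R^2$ which is parametrised by its normal angle: with $\boldsymbol n(\theta)=(\cos\theta,\sin\theta)$ and $\boldsymbol t(\theta)=(-\sin\theta,\cos\theta)$, $\gamma$ is $2\pi$-periodic, injective on $[0,2\pi)$, and $\dot\gamma(\theta)=\rho(\theta)\boldsymbol t(\theta)$ with $\rho(\theta)>0$ for all $\theta$. Let $h(\theta)=\sup_{x\in\gamma}\langle x,\boldsymbol n(\theta)\rangle$ be the support function of $\gamma$. Notation. For $k\in\mathbb N$, $k\ge 1$, and $f:\mathbb R\to\mathbb R$ put $$T_k[f](\theta)=\frac1k\sum_{j=1}^{k} f\Big(\theta+\frac{(2j-1)\pi}{k}\Big),\qquad w_k(\theta)=\sum_{j=0}^{k-1}h\Big(\theta+\frac{2j\pi}{k}\Big).$$ Let $T_k\gamma$ and $T_k^2\gamma$ be the curves with support functions $T_k[h]$ and $(T_k)^2[h]$, where the curve with support function $f$ is $\theta\mapsto f\boldsymbol n+\dot f\,\boldsymbol t$. Let $J$ be the anti-clockwise rotation by $\pi/2$. For a curve $\beta$ parametrised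 by the normal angle, the $r$-th order locus of curvature centers $\beta_{(r)}$ is defined by $\beta_{(0)}=\beta$ and $\beta_{(r+1)}=\beta_{(r)}-\rho_r\,J^r\boldsymbol n$, where $\rho_r=\langle\dot\beta_{(r)},J^{r+1}\boldsymbol n\rangle$ is the signed radius of curvature of $\beta_{(r)}$ with respect to the unit normal $J^r\boldsymbol n$. Finally $F[\beta]=\frac12\int_0^{2\pi}(x\dot y-y\dot x)\,d\theta$ is the algebraic area of a closed curve $\beta=(x,y)$, and the algebraic mixed area $F[\cdot,\cdot]$ is the symmetric bilinear form with $F[\beta,\beta]=F[\beta]$. Let $k\ge2$ and $m\ge1$ be integers. When $m$ is odd, $$\begin{aligned} 0 \le&- \sum_{r=0}^{m-1}(-1)^{r}\binom{m-1}{r} F[\gamma_{(r)}] +\frac{1}{k} \int_{0}^{\pi/k} w_{k}(\theta) w_{k}\Big(\theta+\frac{\pi}{k}\Big) d \theta\\ &- \sum_{\substack{1\le j \le m-1\\ 2 \mid j}}\binom{m}{j} \sum_{r=0}^{m-1}(-1)^{r}\binom{m-1-j}{r} F\left[\gamma_{(r)}, (T_{k}^{2} \gamma)_{(r)}\right] \\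 &+ \sum_{\substack{1\le j \le m-1\\ 2 \nmid j}}\binom{m}{j} \sum_{r=0}^{m-1}(-1)^{r}\binom{m-1-j}{r} F\left[\gamma_{(r)}, (T_{k} \gamma)_{(r)}\right]. \end{aligned}$$ When $m$ is even, $$\begin{aligned} 0 \le& \sum_{r=0}^{m-1}(-1)^{r}\binom{m-1}{r} F[\gamma_{(r)}] +\frac{1}{2k} \int_{0}^{2\pi/k} w_{k}(\theta)^2\, d \theta\\ &+ \sum_{\substack{1\le j \le m-1\\ 2 \mid j}}\binom{m}{j} \sum_{r=0}^{m-1}(-1)^{r}\binom{m-1-j}{r} F\left[\gamma_{(r)}, (T_{k}^{2} \gamma)_{(r)}\right] \\ &- \sum_{\substack{1\le j \le m-1\\ 2 \nmid j}}\binom{m}{j} \sum_{r=0}^{m-1}(-1)^{r}\binom{m-1-j}{r} F\left[\gamma_{(r)}, (T_{k} \gamma)_{(r)}\right]. \end{aligned}$$ In each case equality holds if and only if $\gamma$ is a circle (of positive radius). In particular, for $m=1$ one has the Ou–Pan inequality $$F[\gamma]\le\frac1k\int_0^{\pi/k}w_k(\theta)\,w_k\Big(\theta+\frac\pi k\Big)d\theta,$$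 and, for $m=1$, $k=2$, with the width $w(\theta)=h(\theta)+h(\theta+\pi)$, the Chernoff inequality $$F[\gamma]\le\frac12\int_0^{\pi/2}w(\theta)\,w\Big(\theta+\frac\pi2\Big)d\theta,$$ each with equality if and only if $\gamma$ is a circle. -/

import Mathlib

open scoped ContDiff

noncomputable section

namespace Chernoff

/-- The unit vector `n(θ) = (cos θ, sin θ)`; the Euclidean plane is identified with `ℂ`, so that
multiplication by `Complex.I` is the anti-clockwise rotation `J` by `π / 2`, and the unit
vector `t(θ) = (-sin θ, cos θ)` is `Complex.I * normalVec θ`. -/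
def normalVec (θ : ℝ) : ℂ := Complex.exp (θ * Complex.I)

/-- `γ` is a smooth regular simple closed plane curve parametrised by its normal angle:
it is `C^∞`, `2π`-periodic, injective on a period, and its velocity at parameter `θ` is a positive
multiple `ρ(θ) t(θ)` of `t(θ) = J n(θ)`, i.e. `n(θ)` is the outward unit normal at `γ(θ)` of the
positively oriented curve (and `ρ(θ)` is the radius of curvature). -/
structure IsNormalAngleCurve (γ : ℝ → ℂ) : Prop where
  smooth : ContDiff ℝ ∞ γ
  closed : Function.Periodic γ (2 * Real.pi)
  simple : Set.InjOn γ (Set.Ico 0 (2 * Real.pi))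
  normal : ∀ θ : ℝ, ∃ ρ : ℝ, 0 < ρ ∧ deriv γ θ = (ρ : ℂ) * (Complex.I * normalVec θ)

/-- The support function `h(θ) = sup {⟨x, n(θ)⟩ : x ∈ K}` of a plane set `K`. -/
def supportFun (K : Set ℂ) (θ : ℝ) : ℝ :=
  sSup ((fun x : ℂ => inner ℝ x (normalVec θ)) '' K)

/-- The operator `T_k[h](θ) = (1/k) ∑_{j=1}^k h(θ + (2j-1)π/k)`. -/
def T (k : ℕ) (h : ℝ → ℝ) (θ : ℝ) : ℝ :=
  (1 / (k : ℝ)) * ∑ j ∈ Finset.Icc 1 k, h (θ + (2 * (j : ℝ) - 1) * Real.pi / k)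

/-- The generalized width `w_k(θ) = ∑_{j=0}^{k-1} h(θ + 2jπ/k)` of a curve with support
function `h`. -/
def genWidth (k : ℕ) (h : ℝ → ℝ) (θ : ℝ) : ℝ :=
  ∑ j ∈ Finset.range k, h (θ + 2 * (j : ℝ) * Real.pi / k)

/-- The curve with support function `h`, parametrised by the normal angle:
`θ ↦ h(θ) n(θ) + h'(θ) t(θ)`. -/
def curveOfSupport (h : ℝ → ℝ) (θ : ℝ) : ℂ :=
  ((h θ : ℝ) : ℂ) * normalVec θ + ((deriv h θ : ℝ) : ℂ) * (Complex.I * normalVec θ)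

/-- The curve `(T_k)^j γ`, whose support function is `(T_k)^j[h]`, `h` being the support function
of `γ`. -/
def iterTCurve (k j : ℕ) (γ : ℝ → ℂ) : ℝ → ℂ :=
  curveOfSupport ((T k)^[j] (supportFun (Set.range γ)))

/-- The locus of curvature centers `β - ρ ν` of a curve `β` with respect to a unit normal field `ν`
which rotates at unit speed (`ν' = J ν`). Here `ρ = ⟨β', J ν⟩` is the signed radius of curvature
with respect to `ν`, given by `β' = ρ ν'`. -/
def centerLocus (β ν : ℝ → ℂ) (θ : ℝ) : ℂ :=
  β θ - ((inner ℝ (deriv β θ) (Complex.I * ν θ) : ℝ) : ℂ) * ν θ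

/-- The `r`-th order locus of curvature centers `β_(r)` of a curve `β` parametrised by its normal
angle: `β_(0) = β`, and `β_(r+1)` is the locus of curvature centers of `β_(r)` with respect to the
normal `J^r n`. -/
def iterLocus (β : ℝ → ℂ) : ℕ → ℝ → ℂ
  | 0 => β
  | r + 1 => centerLocus (iterLocus β r) (fun θ => Complex.I ^ r * normalVec θ)

/-- The algebraic area `(1/2) ∫ x dy - y dx` of a `2π`-periodic parametrised curve. -/
def algArea (β : ℝ → ℂ) : ℝ :=
  (1 / 2) * ∫ θ in (0 : ℝ)..(2 * Real.pi),
    ((β θ).re * (deriv β θ).im - (β θ).im * (deriv β θ).re)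

/-- The algebraic mixed area of two `2π`-periodic parametrised curves: the symmetric bilinear form
whose quadratic form is the algebraic area. If the curves have support functions `f` and `g` with
respect to the same normal field `J^r n`, it is `(1/2) ∫ (f g - f' g')`. -/
def mixedArea (β η : ℝ → ℂ) : ℝ :=
  (1 / 4) * ∫ θ in (0 : ℝ)..(2 * Real.pi),
    (((β θ).re * (deriv η θ).im - (β θ).im * (deriv η θ).re)
      + ((η θ).re * (deriv β θ).im - (η θ).im * (deriv β θ).re))

/-- The sum `∑_{r=0}^{m-1} (-1)^r C(m-1,r) F[γ_(r)]`. -/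
def areaSum (m : ℕ) (γ : ℝ → ℂ) : ℝ :=
  ∑ r ∈ Finset.range m, (-1 : ℝ) ^ r * ((m - 1).choose r : ℝ) * algArea (iterLocus γ r)

/-- The sum `∑_{r=0}^{m-1} (-1)^r C(m-1-j,r) F[γ_(r), η_(r)]` (used for `1 ≤ j ≤ m - 1`). -/
def mixedSum (m j : ℕ) (γ η : ℝ → ℂ) : ℝ :=
  ∑ r ∈ Finset.range m, (-1 : ℝ) ^ r * ((m - 1 - j).choose r : ℝ) *
    mixedArea (iterLocus γ r) (iterLocus η r)

/-- The right-hand side of the inequality for odd `m`. -/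
def oddExpr (k m : ℕ) (γ : ℝ → ℂ) : ℝ :=
  - areaSum m γ
  + (1 / (k : ℝ)) * (∫ θ in (0 : ℝ)..(Real.pi / k),
      genWidth k (supportFun (Set.range γ)) θ *
        genWidth k (supportFun (Set.range γ)) (θ + Real.pi / k))
  - (∑ j ∈ (Finset.Icc 1 (m - 1)).filter Even,
      (m.choose j : ℝ) * mixedSum m j γ (iterTCurve k 2 γ))
  + ∑ j ∈ (Finset.Icc 1 (m - 1)).filter Odd,
      (m.choose j : ℝ) * mixedSum m j γ (iterTCurve k 1 γ)

/-- The right-hand side of the inequality for even `m`. -/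
def evenExpr (k m : ℕ) (γ : ℝ → ℂ) : ℝ :=
  areaSum m γ
  + (1 / (2 * (k : ℝ))) * (∫ θ in (0 : ℝ)..(2 * Real.pi / k),
      genWidth k (supportFun (Set.range γ)) θ ^ 2)
  + (∑ j ∈ (Finset.Icc 1 (m - 1)).filter Even,
      (m.choose j : ℝ) * mixedSum m j γ (iterTCurve k 2 γ))
  - ∑ j ∈ (Finset.Icc 1 (m - 1)).filter Odd,
      (m.choose j : ℝ) * mixedSum m j γ (iterTCurve k 1 γ)

/-- The trace of `γ` is a circle (of positive radius). -/
def IsCircle (γ : ℝ → ℂ) : Prop :=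
  ∃ (c : ℂ) (R : ℝ), 0 < R ∧ Set.range γ = Metric.sphere c R

end Chernoff

end

/-!
The proof compares Fourier coefficients. Since `⟨γ(φ), n(θ)⟩` has derivative `ρ(φ) sin(θ - φ)` in
`φ`, the supremum defining the support function `h` is attained at `φ = θ`
(`IsNormalAngleCurve.supportFun_eq`). Hence `h` is smooth, `γ = h n + h' t`, and the radius of
curvature of `γ` is `h + h''`.

Passing to the locus of curvature centers differentiates the support function and turns the normal
field by `π / 2` (`centerLocus_supportCurve`). If `a_n` and `b_n` are the Fourier coefficients of the
support functions of two curves, Parseval's identity therefore gives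
`F[β_(r), η_(r)] = π ∑ (1 - n²) n^{2r} Re (conj a_n * b_n)`, and the alternating binomial sum over
`r` turns the factor `(1 - n²) n^{2r}` into `(1 - n²)^{m-j}` (`hasSum_mixedSum`). The operator `T_k`
multiplies the `n`-th coefficient by `τ_n`, which is `(-1)^{n/k}` if `k ∣ n` and `0` otherwise
(`coeff_T`), and the integrals of the generalized width are `π ∑ τ_n |a_n|²` and `π ∑ τ_n² |a_n|²`.

As `τ_n ∈ {0, 1, -1}`, the powers of `τ_n` with positive exponent are `τ_n` or `τ_n²` according to
parity, so the whole expression, for odd as for even `m`, is a binomial expansion: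
it equals `π ∑ (n² - 1 + τ_n)^m |a_n|²` (`hasSum_oddExpr`, `hasSum_evenExpr`). For `k ≥ 2` the base
`n² - 1 + τ_n` is zero for `|n| ≤ 1` and positive for `|n| ≥ 2`. This proves the inequality, and
equality means that `a_n = 0` for `|n| ≥ 2`, which says that the radius of curvature `h + h''` is
constant, i.e. that `γ` is a circle (`IsNormalAngleCurve.isCircle_iff`).
-/

open scoped ComplexConjugate

namespace Chernoff

/-! ### Fourier coefficients of smooth periodic functions -/

/-- A `C^∞` real function with period `2π`. -/
structure IsSmoothPeriodic (f : ℝ → ℝ) : Prop where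
  smooth : ContDiff ℝ ∞ f
  periodic : Function.Periodic f (2 * Real.pi)

/-- The `n`-th Fourier coefficient `(1 / 2π) ∫ f(x) e^{-inx} dx` of a `2π`-periodic function. -/
noncomputable def coeff (f : ℝ → ℝ) (n : ℤ) : ℂ :=
  (1 / (2 * Real.pi) : ℂ) * ∫ x in (0 : ℝ)..(2 * Real.pi),
    Complex.exp (-(n * x * Complex.I)) * (f x : ℂ)

namespace IsSmoothPeriodic

variable {f g : ℝ → ℝ}

lemma continuous (hf : IsSmoothPeriodic f) : Continuous f := hf.smooth.continuous

lemma hasDerivAt (hf : IsSmoothPeriodic f) (x : ℝ) : HasDerivAt f (deriv f x) x :=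
  (hf.smooth.differentiable (by simp) x).hasDerivAt

protected lemma deriv (hf : IsSmoothPeriodic f) : IsSmoothPeriodic (deriv f) where
  smooth := by
    have := hf.smooth.iterate_deriv 1
    simpa using this
  periodic x := by
    have h : (fun y => f (y + 2 * Real.pi)) = f := funext hf.periodic
    rw [← deriv_comp_add_const, h]

lemma iterate_deriv (hf : IsSmoothPeriodic f) (r : ℕ) : IsSmoothPeriodic (deriv^[r] f) := by
  induction r with
  | zero => exact hf
  | succ r ih => rw [Function.iterate_succ_apply']; exact ih.deriv

lemma shift (hf : IsSmoothPeriodic f) (s : ℝ) : IsSmoothPeriodic (fun x => f (x + s)) where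
  smooth := hf.smooth.comp (contDiff_id.add contDiff_const)
  periodic x := by
    change f (x + 2 * Real.pi + s) = f (x + s)
    rw [← hf.periodic (x + s)]; ring_nf

lemma add (hf : IsSmoothPeriodic f) (hg : IsSmoothPeriodic g) :
    IsSmoothPeriodic (fun x => f x + g x) :=
  ⟨hf.smooth.add hg.smooth, fun x => by simp only [hf.periodic x, hg.periodic x]⟩

lemma const_mul (hf : IsSmoothPeriodic f) (c : ℝ) : IsSmoothPeriodic (fun x => c * f x) :=
  ⟨contDiff_const.mul hf.smooth, fun x => by simp only [hf.periodic x]⟩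

lemma sum {ι : Type*} (s : Finset ι) {F : ι → ℝ → ℝ} (hF : ∀ i ∈ s, IsSmoothPeriodic (F i)) :
    IsSmoothPeriodic (fun x => ∑ i ∈ s, F i x) :=
  ⟨ContDiff.sum fun i hi => (hF i hi).smooth,
    fun x => Finset.sum_congr rfl fun i hi => (hF i hi).periodic x⟩

end IsSmoothPeriodic

lemma continuous_coeff_integrand {f : ℝ → ℝ} (hf : Continuous f) (n : ℤ) :
    Continuous fun x : ℝ => Complex.exp (-(n * x * Complex.I)) * (f x : ℂ) := by
  fun_prop

lemma coeff_sum {ι : Type*} (s : Finset ι) {F : ι → ℝ → ℝ} (hF : ∀ i ∈ s, Continuous (F i))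
    (n : ℤ) : coeff (fun x => ∑ i ∈ s, F i x) n = ∑ i ∈ s, coeff (F i) n := by
  simp only [coeff, Complex.ofReal_sum, Finset.mul_sum]
  rw [intervalIntegral.integral_finsetSum, Finset.mul_sum]
  exact fun i hi => (continuous_coeff_integrand (hF i hi) n).intervalIntegrable _ _

lemma coeff_add {f g : ℝ → ℝ} (hf : Continuous f) (hg : Continuous g) (n : ℤ) :
    coeff (fun x => f x + g x) n = coeff f n + coeff g n := by
  simp only [coeff, Complex.ofReal_add, mul_add]
  rw [intervalIntegral.integral_add, mul_add]
  · exact (continuous_coeff_integrand hf n).intervalIntegrable _ _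
  · exact (continuous_coeff_integrand hg n).intervalIntegrable _ _

lemma coeff_const_mul (c : ℝ) (f : ℝ → ℝ) (n : ℤ) :
    coeff (fun x => c * f x) n = c * coeff f n := by
  simp only [coeff, Complex.ofReal_mul]
  simp only [mul_left_comm _ (c : ℂ), intervalIntegral.integral_const_mul]

lemma exp_neg_int_mul_periodic (n : ℤ) (x : ℝ) :
    Complex.exp (-(n * ((x + 2 * Real.pi : ℝ) : ℂ) * Complex.I))
      = Complex.exp (-(n * x * Complex.I)) := by
  rw [Complex.exp_eq_exp_iff_exists_int]
  exact ⟨-n, by push_cast; ring⟩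

lemma coeff_shift {f : ℝ → ℝ} (hf : Function.Periodic f (2 * Real.pi)) (s : ℝ) (n : ℤ) :
    coeff (fun x => f (x + s)) n = Complex.exp (n * s * Complex.I) * coeff f n := by
  set G : ℝ → ℂ := fun x => Complex.exp (-(n * x * Complex.I)) * (f x : ℂ) with hG
  have hGp : Function.Periodic G (2 * Real.pi) := fun x => by
    simp only [hG, exp_neg_int_mul_periodic, hf x]
  have h1 : ∀ x : ℝ, Complex.exp (-(n * x * Complex.I)) * (f (x + s) : ℂ)
      = Complex.exp (n * s * Complex.I) * G (x + s) := fun x => by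
    simp only [hG]
    rw [← mul_assoc, ← Complex.exp_add]
    push_cast
    congr 2; ring
  simp only [coeff, h1]
  rw [intervalIntegral.integral_const_mul, intervalIntegral.integral_comp_add_right, zero_add,
    add_comm (2 * Real.pi), hGp.intervalIntegral_add_eq s 0, zero_add]
  ring

/-- Differentiation multiplies the `n`-th Fourier coefficient by `in`. -/
lemma coeff_deriv {f : ℝ → ℝ} (hf : IsSmoothPeriodic f) (n : ℤ) :
    coeff (deriv f) n = n * Complex.I * coeff f n := by
  have hu : ∀ x : ℝ, HasDerivAt (fun x : ℝ => Complex.exp (-(n * x * Complex.I)))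
      (-(n * Complex.I) * Complex.exp (-(n * x * Complex.I))) x := fun x => by
    have h : HasDerivAt (fun z : ℂ => Complex.exp (-(n * z * Complex.I)))
        (Complex.exp (-(n * (x : ℂ) * Complex.I)) * (-(n * 1 * Complex.I))) (x : ℂ) :=
      ((((hasDerivAt_id (x : ℂ)).const_mul (n : ℂ)).mul_const Complex.I).neg).cexp
    convert h.comp_ofReal using 1
    ring
  have hv : ∀ x : ℝ, HasDerivAt (fun x : ℝ => (f x : ℂ)) ((deriv f x : ℝ) : ℂ) x :=
    fun x => (hf.hasDerivAt x).ofReal_comp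
  have hc := hf.deriv.continuous
  have key := intervalIntegral.integral_mul_deriv_eq_deriv_mul (a := 0) (b := 2 * Real.pi)
    (fun x _ => hu x) (fun x _ => hv x)
    (Continuous.intervalIntegrable (by fun_prop) _ _)
    (Continuous.intervalIntegrable (by fun_prop) _ _)
  have hb : Complex.exp (-(n * ((2 * Real.pi : ℝ) : ℂ) * Complex.I)) = 1 := by
    have := exp_neg_int_mul_periodic n 0
    simpa using this
  have hfb : f (2 * Real.pi) = f 0 := by simpa using hf.periodic 0
  simp only [coeff]
  rw [key, hb, hfb]
  simp only [mul_assoc, intervalIntegral.integral_const_mul, neg_mul, intervalIntegral.integral_neg]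
  simp
  ring

lemma coeff_iterate_deriv {f : ℝ → ℝ} (hf : IsSmoothPeriodic f) (n : ℤ) (r : ℕ) :
    coeff (deriv^[r] f) n = (n * Complex.I) ^ r * coeff f n := by
  induction r with
  | zero => simp
  | succ r ih =>
    rw [Function.iterate_succ_apply', coeff_deriv (hf.iterate_deriv r), ih]
    ring

lemma fourierCoeffOn_eq_coeff (f : ℝ → ℝ) (n : ℤ) :
    fourierCoeffOn Real.two_pi_pos (fun x => (f x : ℂ)) n = coeff f n := by
  rw [fourierCoeffOn_eq_integral, coeff, sub_zero, Complex.real_smul]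
  push_cast
  congr 1
  refine intervalIntegral.integral_congr fun x _ => ?_
  have hpi : (Real.pi : ℂ) ≠ 0 := by exact_mod_cast Real.pi_ne_zero
  simp only [smul_eq_mul]
  rw [fourier_coe_apply]
  congr 2
  push_cast
  field_simp

lemma hasSum_of_eq {u v : ℤ → ℝ} {a b : ℝ} (h : HasSum u a) (huv : ∀ n, v n = u n)
    (hab : b = a) : HasSum v b := by
  rwa [hab, funext huv]

lemma hasSum_normSq_coeff {f : ℝ → ℝ} (hf : Continuous f) :
    HasSum (fun n => Complex.normSq (coeff f n))
      (1 / (2 * Real.pi) * ∫ x in (0 : ℝ)..(2 * Real.pi), f x * f x) := by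
  have hmem : MeasureTheory.MemLp (fun x => (f x : ℂ)) 2
      (MeasureTheory.volume.restrict (Set.Ioc 0 (2 * Real.pi))) := by
    have hc : Continuous fun x => (f x : ℂ) := by fun_prop
    obtain ⟨C, hC⟩ := (isCompact_Icc (a := (0 : ℝ)) (b := 2 * Real.pi)).exists_bound_of_continuousOn
      hc.continuousOn
    refine MeasureTheory.MemLp.of_bound hc.aestronglyMeasurable C ?_
    filter_upwards [MeasureTheory.ae_restrict_mem measurableSet_Ioc] with x hx
    exact hC x (Set.Ioc_subset_Icc_self hx)
  have h := hasSum_sq_fourierCoeffOn Real.two_pi_pos hmem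
  simp only [fourierCoeffOn_eq_coeff, sub_zero, smul_eq_mul, Complex.norm_real, Real.norm_eq_abs,
    sq_abs, ← Complex.normSq_eq_norm_sq] at h
  simpa only [one_div, ← pow_two] using h

/-- **Parseval's identity**, in bilinear form. -/
lemma hasSum_coeff_mul {f g : ℝ → ℝ} (hf : Continuous f) (hg : Continuous g) :
    HasSum (fun n => (conj (coeff f n) * coeff g n).re)
      (1 / (2 * Real.pi) * ∫ x in (0 : ℝ)..(2 * Real.pi), f x * g x) := by
  have h1 := hasSum_normSq_coeff (hf.add hg)
  -- polarization: `4 f g = (f + g)² - (f - g)²`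
  have h2 := hasSum_normSq_coeff (f := fun x => f x + (-1) * g x) (by fun_prop)
  have h := (h1.sub h2).mul_left (1 / 4)
  have e1 : ∀ n, coeff (f + g) n = coeff f n + coeff g n := coeff_add hf hg
  have e2 : ∀ n, coeff (fun x => f x + (-1) * g x) n = coeff f n - coeff g n := fun n => by
    rw [coeff_add hf (by fun_prop), coeff_const_mul]; push_cast; ring
  refine hasSum_of_eq h (fun n => ?_) ?_
  · rw [e1, e2, Complex.normSq_apply, Complex.normSq_apply]
    simp
    ring
  · have key : (∫ x in (0 : ℝ)..(2 * Real.pi), (f + g) x * (f + g) x)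
        - (∫ x in (0 : ℝ)..(2 * Real.pi), (f x + (-1) * g x) * (f x + (-1) * g x))
        = 4 * ∫ x in (0 : ℝ)..(2 * Real.pi), f x * g x := by
      rw [← intervalIntegral.integral_sub, ← intervalIntegral.integral_const_mul]
      · refine intervalIntegral.integral_congr fun x _ => ?_
        simp only [Pi.add_apply]; ring
      · exact ((hf.add hg).mul (hf.add hg)).intervalIntegrable _ _
      · exact Continuous.intervalIntegrable (by fun_prop) _ _
    linear_combination (-(1 / 4) * (1 / (2 * Real.pi))) * key

/-- A continuous periodic function all of whose Fourier coefficients vanish is zero. -/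
lemma eq_zero_of_coeff_eq_zero {f : ℝ → ℝ} (hf : Continuous f)
    (hp : Function.Periodic f (2 * Real.pi)) (h0 : ∀ n, coeff f n = 0) (θ : ℝ) : f θ = 0 := by
  have h := hasSum_normSq_coeff hf
  simp only [h0, map_zero] at h
  have hI := h.unique hasSum_zero
  by_contra hne
  obtain ⟨x, hx, hfx⟩ := hp.exists_mem_Ico₀ Real.two_pi_pos θ
  have hpos : 0 < ∫ x in (0 : ℝ)..(2 * Real.pi), f x * f x :=
    intervalIntegral.integral_pos Real.two_pi_pos (hf.mul hf).continuousOn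
      (fun y _ => mul_self_nonneg _)
      ⟨x, Set.Ico_subset_Icc_self hx, mul_self_pos.mpr (hfx ▸ hne)⟩
  have : 0 < 1 / (2 * Real.pi) := by positivity
  exact (mul_pos this hpos).ne' hI

/-! ### The averaging operator and the generalized width -/

/-- The factor by which `T k` multiplies the `n`-th Fourier coefficient: `(-1)^{n/k}` if `k ∣ n`,
and `0` otherwise. -/
noncomputable def multiplier (k : ℕ) (n : ℤ) : ℝ :=
  if (k : ℤ) ∣ n then (-1) ^ (n / (k : ℤ)) else 0

lemma multiplier_of_not_dvd {k : ℕ} {n : ℤ} (h : ¬ (k : ℤ) ∣ n) : multiplier k n = 0 := by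
  simp [multiplier, h]

lemma multiplier_eq_or (k : ℕ) (n : ℤ) :
    multiplier k n = 0 ∨ multiplier k n = 1 ∨ multiplier k n = -1 := by
  unfold multiplier
  split_ifs
  · right
    rcases Int.even_or_odd (n / (k : ℤ)) with h | h
    · exact Or.inl h.neg_one_zpow
    · exact Or.inr h.neg_one_zpow
  · exact Or.inl rfl

/-- The sum over the `k`-th roots of unity of their `n`-th powers. -/
lemma sum_exp_eq {k : ℕ} (hk : 0 < k) (n : ℤ) :
    ∑ j ∈ Finset.range k, Complex.exp (n * ((2 * (j : ℝ) * Real.pi / k : ℝ) : ℂ) * Complex.I)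
      = if (k : ℤ) ∣ n then (k : ℂ) else 0 := by
  have hk0 : (k : ℂ) ≠ 0 := by exact_mod_cast hk.ne'
  set ζ : ℂ := Complex.exp (n * 2 * Real.pi * Complex.I / k) with hζ
  have hpow : ∀ j ∈ Finset.range k,
      Complex.exp (n * ((2 * (j : ℝ) * Real.pi / k : ℝ) : ℂ) * Complex.I) = ζ ^ j := fun j _ => by
    rw [hζ, ← Complex.exp_nat_mul]
    push_cast
    congr 1; ring
  rw [Finset.sum_congr rfl hpow]
  have hpi : (Real.pi : ℂ) ≠ 0 := by exact_mod_cast Real.pi_ne_zero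
  split_ifs with h
  · obtain ⟨l, rfl⟩ := h
    have : ζ = 1 := by
      rw [hζ, Complex.exp_eq_one_iff]
      exact ⟨l, by push_cast; field_simp⟩
    simp [this]
  · have h1 : ζ ≠ 1 := fun h1 => h <| by
      rw [hζ, Complex.exp_eq_one_iff] at h1
      obtain ⟨l, hl⟩ := h1
      refine ⟨l, ?_⟩
      have hI := Complex.I_ne_zero
      field_simp at hl
      have : (n : ℂ) = (k * l : ℤ) := by push_cast; linear_combination hl
      exact_mod_cast this
    have hk1 : ζ ^ k = 1 := by
      rw [hζ, ← Complex.exp_nat_mul, Complex.exp_eq_one_iff]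
      exact ⟨n, by field_simp⟩
    rw [geom_sum_eq h1, hk1, sub_self, zero_div]

lemma IsSmoothPeriodic.genWidth {f : ℝ → ℝ} (hf : IsSmoothPeriodic f) (k : ℕ) :
    IsSmoothPeriodic (genWidth k f) :=
  IsSmoothPeriodic.sum _ fun _ _ => hf.shift _

lemma coeff_genWidth {f : ℝ → ℝ} (hf : IsSmoothPeriodic f) {k : ℕ} (hk : 0 < k) (n : ℤ) :
    coeff (genWidth k f) n = (if (k : ℤ) ∣ n then (k : ℂ) else 0) * coeff f n := by
  rw [← sum_exp_eq hk, Finset.sum_mul]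
  refine (coeff_sum _ (fun j _ => (hf.shift _).continuous) n).trans ?_
  exact Finset.sum_congr rfl fun j _ => coeff_shift hf.periodic _ _

lemma genWidth_periodic {f : ℝ → ℝ} (hf : Function.Periodic f (2 * Real.pi)) {k : ℕ}
    (hk : 0 < k) : Function.Periodic (genWidth k f) (2 * Real.pi / k) := fun θ => by
  have hk0 : (k : ℝ) ≠ 0 := by exact_mod_cast hk.ne'
  have h : ∀ j : ℕ, f (θ + 2 * Real.pi / k + 2 * (j : ℝ) * Real.pi / k)
      = (fun i : ℕ => f (θ + 2 * (i : ℝ) * Real.pi / k)) (j + 1) := fun j => by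
    simp only; congr 1; push_cast; ring
  -- the shift permutes the `k` summands cyclically, the last one returning by periodicity of `f`
  simp only [genWidth, h]
  have hsum := Finset.sum_range_succ' (fun i : ℕ => f (θ + 2 * (i : ℝ) * Real.pi / k)) k
  rw [Finset.sum_range_succ] at hsum
  have hlast : f (θ + 2 * (k : ℝ) * Real.pi / k) = f (θ + 2 * ((0 : ℕ) : ℝ) * Real.pi / k) := by
    rw [show θ + 2 * (k : ℝ) * Real.pi / k = θ + 2 * Real.pi by field_simp, hf θ]
    simp
  linarith

lemma T_eq_genWidth (k : ℕ) (f : ℝ → ℝ) :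
    T k f = fun θ => (1 / (k : ℝ)) * genWidth k f (θ + Real.pi / k) := by
  ext θ
  simp only [T, genWidth]
  rw [Finset.range_eq_Ico, ← Finset.Ico_add_one_right_eq_Icc,
    ← Finset.sum_Ico_add' (fun j : ℕ => f (θ + (2 * (j : ℝ) - 1) * Real.pi / k)) 0 k 1]
  congr 1
  refine Finset.sum_congr rfl fun j _ => ?_
  congr 1; push_cast; ring

lemma IsSmoothPeriodic.T {f : ℝ → ℝ} (hf : IsSmoothPeriodic f) (k : ℕ) :
    IsSmoothPeriodic (T k f) := by
  rw [T_eq_genWidth]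
  exact ((hf.genWidth k).shift _).const_mul _

lemma IsSmoothPeriodic.iterate_T {f : ℝ → ℝ} (hf : IsSmoothPeriodic f) (k i : ℕ) :
    IsSmoothPeriodic ((Chernoff.T k)^[i] f) := by
  induction i with
  | zero => exact hf
  | succ i ih => rw [Function.iterate_succ_apply']; exact ih.T k

lemma coeff_T {f : ℝ → ℝ} (hf : IsSmoothPeriodic f) {k : ℕ} (hk : 0 < k) (n : ℤ) :
    coeff (T k f) n = multiplier k n * coeff f n := by
  have hk0 : (k : ℂ) ≠ 0 := by exact_mod_cast hk.ne'
  rw [T_eq_genWidth, coeff_const_mul, coeff_shift (hf.genWidth k).periodic, coeff_genWidth hf hk,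
    multiplier]
  split_ifs with h
  · obtain ⟨l, rfl⟩ := h
    have hkz : (k : ℤ) ≠ 0 := by exact_mod_cast hk.ne'
    rw [Int.mul_ediv_cancel_left _ hkz]
    have he : Complex.exp (((k * l : ℤ) : ℂ) * ((Real.pi / k : ℝ) : ℂ) * Complex.I)
        = (-1) ^ l := by
      rw [← Complex.exp_pi_mul_I, ← Complex.exp_int_mul]
      congr 1; push_cast; field_simp
    rw [he]
    push_cast
    field_simp
  · simp

lemma coeff_iterate_T {f : ℝ → ℝ} (hf : IsSmoothPeriodic f) {k : ℕ} (hk : 0 < k) (n : ℤ)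
    (i : ℕ) : coeff ((T k)^[i] f) n = (multiplier k n ^ i : ℝ) * coeff f n := by
  induction i with
  | zero => simp
  | succ i ih =>
    rw [Function.iterate_succ_apply', coeff_T (hf.iterate_T k i) hk, ih]
    push_cast; ring

/-- The integral of a continuous function of period `p` over `k` periods. -/
lemma integral_nat_mul_period {F : ℝ → ℝ} {p : ℝ} (hF : Continuous F)
    (hp : Function.Periodic F p) (k : ℕ) :
    ∫ θ in (0 : ℝ)..(k * p), F θ = k * ∫ θ in (0 : ℝ)..p, F θ := by
  have h := hp.intervalIntegral_add_zsmul_eq k 0 fun _ _ => hF.intervalIntegrable _ _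
  simpa using h

lemma hasSum_integral_genWidth_sq {f : ℝ → ℝ} (hf : IsSmoothPeriodic f) {k : ℕ} (hk : 0 < k) :
    HasSum (fun n => Real.pi * multiplier k n ^ 2 * Complex.normSq (coeff f n))
      (1 / (2 * (k : ℝ)) * ∫ θ in (0 : ℝ)..(2 * Real.pi / k), genWidth k f θ ^ 2) := by
  have hk0 : (k : ℝ) ≠ 0 := by exact_mod_cast hk.ne'
  have hw := hf.genWidth k
  have hint := integral_nat_mul_period (F := fun θ => genWidth k f θ ^ 2) (hw.continuous.pow 2)
    (p := 2 * Real.pi / k) (fun θ => by simp only [genWidth_periodic hf.periodic hk θ]) k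
  have h := (hasSum_normSq_coeff hw.continuous).mul_left (Real.pi / (k : ℝ) ^ 2)
  refine hasSum_of_eq h (fun n => ?_) ?_
  · rw [coeff_genWidth hf hk, Complex.normSq_mul, multiplier]
    split_ifs
    · rw [← zpow_natCast, ← zpow_mul, mul_comm _ ((2 : ℕ) : ℤ), zpow_mul]
      simp
      field_simp
    · simp
  · rw [mul_div_cancel₀ _ hk0] at hint
    simp only [← pow_two]
    rw [hint]
    field_simp

lemma hasSum_integral_genWidth_mul_shift {f : ℝ → ℝ} (hf : IsSmoothPeriodic f) {k : ℕ}
    (hk : 0 < k) :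
    HasSum (fun n => Real.pi * multiplier k n * Complex.normSq (coeff f n))
      (1 / (k : ℝ) * ∫ θ in (0 : ℝ)..(Real.pi / k),
        genWidth k f θ * genWidth k f (θ + Real.pi / k)) := by
  have hk0 : (k : ℝ) ≠ 0 := by exact_mod_cast hk.ne'
  have hw := hf.genWidth k
  have hT : ∀ θ, genWidth k f (θ + Real.pi / k) = k * T k f θ := fun θ => by
    rw [T_eq_genWidth]; field_simp
  -- the integrand has period `π / k`, because the width has period `2π / k`
  have hint := integral_nat_mul_period
    (F := fun θ => genWidth k f θ * genWidth k f (θ + Real.pi / k)) (p := Real.pi / k)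
    (hw.continuous.mul (hw.shift _).continuous)
    (fun θ => by
      have := genWidth_periodic hf.periodic hk θ
      simp only
      rw [show θ + Real.pi / k + Real.pi / k = θ + 2 * Real.pi / k by ring, this, mul_comm]) (2 * k)
  have h := (hasSum_coeff_mul hw.continuous (hf.T k).continuous).mul_left (Real.pi / (k : ℝ))
  refine hasSum_of_eq h (fun n => ?_) ?_
  · rw [coeff_genWidth hf hk, coeff_T hf hk, Complex.normSq_apply]
    split_ifs with hd
    · simp
      field_simp
    · simp [multiplier_of_not_dvd hd]
  · rw [show ((2 * k : ℕ) : ℝ) * (Real.pi / k) = 2 * Real.pi by push_cast; field_simp] at hint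
    have h2 : ∫ θ in (0 : ℝ)..(2 * Real.pi), genWidth k f θ * genWidth k f (θ + Real.pi / k)
        = k * ∫ θ in (0 : ℝ)..(2 * Real.pi), genWidth k f θ * T k f θ := by
      rw [← intervalIntegral.integral_const_mul]
      refine intervalIntegral.integral_congr fun θ _ => ?_
      simp only [hT]; ring
    rw [h2] at hint
    push_cast at hint
    have hpi := Real.pi_ne_zero
    set A := ∫ θ in (0 : ℝ)..(2 * Real.pi), genWidth k f θ * T k f θ
    set B := ∫ θ in (0 : ℝ)..(Real.pi / k), genWidth k f θ * genWidth k f (θ + Real.pi / k)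
    have hAB : A = 2 * B := mul_left_cancel₀ hk0 (by linarith)
    rw [hAB]
    field_simp

/-! ### Curves given by a support function and their loci of curvature centers -/

lemma hasDerivAt_normalVec (θ : ℝ) :
    HasDerivAt normalVec (Complex.I * normalVec θ) θ := by
  have h : HasDerivAt (fun z : ℂ => Complex.exp (z * Complex.I))
      (Complex.exp ((θ : ℂ) * Complex.I) * (1 * Complex.I)) (θ : ℂ) :=
    ((hasDerivAt_id (θ : ℂ)).mul_const Complex.I).cexp
  exact h.comp_ofReal.congr_deriv (by rw [normalVec]; ring)

lemma normSq_normalVec (θ : ℝ) : Complex.normSq (normalVec θ) = 1 := by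
  rw [Complex.normSq_eq_norm_sq, normalVec, Complex.norm_exp_ofReal_mul_I, one_pow]

/-- The curve which has support function `f` with respect to the normal field `J^r n`. -/
noncomputable def supportCurve (r : ℕ) (f : ℝ → ℝ) (θ : ℝ) : ℂ :=
  ((f θ : ℝ) : ℂ) * (Complex.I ^ r * normalVec θ)
    + ((deriv f θ : ℝ) : ℂ) * (Complex.I * (Complex.I ^ r * normalVec θ))

lemma curveOfSupport_eq (f : ℝ → ℝ) : curveOfSupport f = supportCurve 0 f := by
  ext θ; simp [curveOfSupport, supportCurve]

lemma hasDerivAt_supportCurve {f : ℝ → ℝ} (hf : IsSmoothPeriodic f) (r : ℕ) (θ : ℝ) :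
    HasDerivAt (supportCurve r f)
      (((f θ + deriv (deriv f) θ : ℝ) : ℂ) * (Complex.I * (Complex.I ^ r * normalVec θ))) θ := by
  have hn : HasDerivAt (fun θ => Complex.I ^ r * normalVec θ)
      (Complex.I * (Complex.I ^ r * normalVec θ)) θ := by
    exact ((hasDerivAt_normalVec θ).const_mul (Complex.I ^ r)).congr_deriv (by ring)
  have h := ((hf.hasDerivAt θ).ofReal_comp.mul hn).add
    ((hf.deriv.hasDerivAt θ).ofReal_comp.mul (hn.const_mul Complex.I))
  refine h.congr_deriv ?_
  push_cast
  linear_combination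
    ((deriv f θ : ℝ) : ℂ) * (Complex.I ^ r * normalVec θ) * Complex.I_mul_I

lemma normSq_I_pow_mul_normalVec (r : ℕ) (θ : ℝ) :
    Complex.normSq (Complex.I ^ r * normalVec θ) = 1 := by
  simp [normSq_normalVec]

/-- Passing to the locus of curvature centers differentiates the support function and turns the
normal field by `π / 2`. -/
lemma centerLocus_supportCurve {f : ℝ → ℝ} (hf : IsSmoothPeriodic f) (r : ℕ) :
    centerLocus (supportCurve r f) (fun θ => Complex.I ^ r * normalVec θ)
      = supportCurve (r + 1) (deriv f) := by
  ext θ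
  have hunit := normSq_I_pow_mul_normalVec r θ
  have hinner : (inner ℝ (deriv (supportCurve r f) θ)
      (Complex.I * (Complex.I ^ r * normalVec θ)) : ℝ) = f θ + deriv (deriv f) θ := by
    rw [(hasDerivAt_supportCurve hf r θ).deriv, Complex.inner]
    generalize Complex.I ^ r * normalVec θ = e at hunit ⊢
    rw [Complex.normSq_apply] at hunit
    simp
    linear_combination (f θ + deriv (deriv f) θ) * hunit
  simp only [centerLocus, hinner, supportCurve, pow_succ]
  push_cast
  linear_combination -((deriv (deriv f) θ : ℝ) : ℂ) * (Complex.I ^ r * normalVec θ)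
    * Complex.I_mul_I

lemma iterLocus_curveOfSupport {f : ℝ → ℝ} (hf : IsSmoothPeriodic f) (r : ℕ) :
    iterLocus (curveOfSupport f) r = supportCurve r (deriv^[r] f) := by
  induction r with
  | zero => exact curveOfSupport_eq f
  | succ r ih =>
    rw [iterLocus, ih, centerLocus_supportCurve (hf.iterate_deriv r), Function.iterate_succ_apply']

lemma algArea_eq_mixedArea (β : ℝ → ℂ) : algArea β = mixedArea β β := by
  simp only [algArea, mixedArea, ← two_mul, intervalIntegral.integral_const_mul]
  ring

lemma mixedArea_supportCurve {f g : ℝ → ℝ} (hf : IsSmoothPeriodic f) (hg : IsSmoothPeriodic g)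
    (r : ℕ) : mixedArea (supportCurve r f) (supportCurve r g) =
      (1 / 4) * ((∫ θ in (0 : ℝ)..(2 * Real.pi), f θ * (g θ + deriv (deriv g) θ))
        + ∫ θ in (0 : ℝ)..(2 * Real.pi), g θ * (f θ + deriv (deriv f) θ)) := by
  have hfc := hf.continuous
  have hgc := hg.continuous
  have hfc2 := hf.deriv.deriv.continuous
  have hgc2 := hg.deriv.deriv.continuous
  rw [mixedArea, ← intervalIntegral.integral_add]
  · congr 1
    refine intervalIntegral.integral_congr fun θ _ => ?_
    simp only [(hasDerivAt_supportCurve hf r θ).deriv, (hasDerivAt_supportCurve hg r θ).deriv,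
      supportCurve]
    have hunit := normSq_I_pow_mul_normalVec r θ
    generalize Complex.I ^ r * normalVec θ = e at hunit ⊢
    rw [Complex.normSq_apply] at hunit
    simp
    linear_combination (f θ * (g θ + deriv (deriv g) θ) + g θ * (f θ + deriv (deriv f) θ)) * hunit
  · exact Continuous.intervalIntegrable (by fun_prop) _ _
  · exact Continuous.intervalIntegrable (by fun_prop) _ _

lemma coeff_add_deriv_deriv {f : ℝ → ℝ} (hf : IsSmoothPeriodic f) (n : ℤ) :
    coeff (fun θ => f θ + deriv (deriv f) θ) n = ((1 - (n : ℝ) ^ 2 : ℝ) : ℂ) * coeff f n := by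
  rw [coeff_add hf.continuous hf.deriv.deriv.continuous, coeff_deriv hf.deriv, coeff_deriv hf]
  push_cast
  linear_combination (n : ℂ) ^ 2 * coeff f n * Complex.I_mul_I

lemma hasSum_mixedArea_supportCurve {f g : ℝ → ℝ} (hf : IsSmoothPeriodic f)
    (hg : IsSmoothPeriodic g) (r : ℕ) :
    HasSum (fun n : ℤ => Real.pi * (1 - (n : ℝ) ^ 2) * (conj (coeff f n) * coeff g n).re)
      (mixedArea (supportCurve r f) (supportCurve r g)) := by
  have h1 := hasSum_coeff_mul hf.continuous (hg.add hg.deriv.deriv).continuous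
  have h2 := hasSum_coeff_mul hg.continuous (hf.add hf.deriv.deriv).continuous
  refine hasSum_of_eq ((h1.add h2).mul_left (Real.pi / 2)) (fun n => ?_) ?_
  · rw [coeff_add_deriv_deriv hf, coeff_add_deriv_deriv hg]
    simp only [Complex.mul_re, Complex.mul_im, Complex.conj_re, Complex.conj_im,
      Complex.ofReal_re, Complex.ofReal_im]
    ring
  · rw [mixedArea_supportCurve hf hg]
    have := Real.pi_ne_zero
    field_simp
    ring

lemma hasSum_mixedArea_iterLocus {f g : ℝ → ℝ} (hf : IsSmoothPeriodic f)
    (hg : IsSmoothPeriodic g) (r : ℕ) :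
    HasSum (fun n : ℤ => Real.pi * (1 - (n : ℝ) ^ 2) * ((n : ℝ) ^ 2) ^ r
        * (conj (coeff f n) * coeff g n).re)
      (mixedArea (iterLocus (curveOfSupport f) r) (iterLocus (curveOfSupport g) r)) := by
  rw [iterLocus_curveOfSupport hf, iterLocus_curveOfSupport hg]
  refine hasSum_of_eq (hasSum_mixedArea_supportCurve (hf.iterate_deriv r) (hg.iterate_deriv r) r)
    (fun n => ?_) rfl
  rw [coeff_iterate_deriv hf, coeff_iterate_deriv hg]
  have : conj ((n * Complex.I) ^ r * coeff f n) * ((n * Complex.I) ^ r * coeff g n)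
      = ((((n : ℝ) ^ 2) ^ r : ℝ) : ℂ) * (conj (coeff f n) * coeff g n) := by
    have hI : conj ((n * Complex.I) ^ r) * (n * Complex.I) ^ r = (((n : ℝ) ^ 2) ^ r : ℝ) := by
      rw [map_pow, ← mul_pow]
      push_cast
      congr 1
      simp only [map_mul, Complex.conj_I, map_intCast]
      linear_combination -(n : ℂ) ^ 2 * Complex.I_mul_I
    rw [map_mul, ← hI]; ring
  rw [this, Complex.re_ofReal_mul]
  ring

lemma sum_range_choose_mul_neg_pow {m q : ℕ} (h : q < m) (y : ℝ) :
    ∑ r ∈ Finset.range m, (-1 : ℝ) ^ r * (q.choose r : ℝ) * y ^ r = (1 - y) ^ q := by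
  have h1 : (1 - y) ^ q = ∑ r ∈ Finset.range (q + 1), (-1 : ℝ) ^ r * (q.choose r : ℝ) * y ^ r := by
    rw [show 1 - y = -y + 1 by ring, add_pow]
    refine Finset.sum_congr rfl fun r _ => ?_
    rw [neg_pow, one_pow]; ring
  rw [h1]
  refine (Finset.sum_subset (Finset.range_mono h) fun r _ hr => ?_).symm
  rw [Nat.choose_eq_zero_of_lt (by simpa using hr)]
  simp

/-- The alternating sum over `r` collapses by the binomial theorem to the factor
`(1 - n²)^{m-j}`. -/
lemma hasSum_mixedSum {f g : ℝ → ℝ} (hf : IsSmoothPeriodic f) (hg : IsSmoothPeriodic g)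
    {m j : ℕ} (hj : j < m) :
    HasSum (fun n : ℤ => Real.pi * (1 - (n : ℝ) ^ 2) ^ (m - j) * (conj (coeff f n) * coeff g n).re)
      (mixedSum m j (curveOfSupport f) (curveOfSupport g)) := by
  refine hasSum_of_eq (hasSum_sum (s := Finset.range m) fun r _ =>
    (hasSum_mixedArea_iterLocus hf hg r).mul_left ((-1 : ℝ) ^ r * ((m - 1 - j).choose r : ℝ)))
    (fun n => ?_) rfl
  have h := sum_range_choose_mul_neg_pow (show m - 1 - j < m by omega) ((n : ℝ) ^ 2)
  rw [show m - j = (m - 1 - j) + 1 by omega, pow_succ, ← h, Finset.sum_mul, Finset.mul_sum,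
    Finset.sum_mul]
  exact Finset.sum_congr rfl fun r _ => by ring

lemma areaSum_eq_mixedSum (m : ℕ) (γ : ℝ → ℂ) : areaSum m γ = mixedSum m 0 γ γ := by
  simp only [areaSum, mixedSum, algArea_eq_mixedArea, Nat.sub_zero]

/-! ### The support function of a curve parametrised by its normal angle -/

lemma inner_normalVec (z : ℂ) (θ : ℝ) :
    (inner ℝ z (normalVec θ) : ℝ) = z.re * Real.cos θ + z.im * Real.sin θ := by
  simp [Complex.inner, normalVec, Complex.exp_ofReal_mul_I_re, Complex.exp_ofReal_mul_I_im]
  ring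

lemma inner_I_mul_normalVec (φ θ : ℝ) :
    (inner ℝ (Complex.I * normalVec φ) (normalVec θ) : ℝ) = Real.sin (θ - φ) := by
  rw [inner_normalVec, Real.sin_sub]
  simp [normalVec, Complex.exp_ofReal_mul_I_re, Complex.exp_ofReal_mul_I_im]
  ring

lemma normalVec_periodic : Function.Periodic normalVec (2 * Real.pi) := fun θ => by
  rw [normalVec, normalVec, Complex.exp_eq_exp_iff_exists_int]
  exact ⟨1, by push_cast; ring⟩

namespace IsNormalAngleCurve

variable {γ : ℝ → ℂ}

lemma differentiable (hγ : IsNormalAngleCurve γ) : Differentiable ℝ γ :=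
  hγ.smooth.differentiable (by simp)

/-- For fixed `θ` the height `⟨γ(φ), n(θ)⟩` has derivative `ρ(φ) sin(θ - φ)` in `φ`, so it
increases up to `φ = θ` and decreases afterwards. -/
lemma inner_le_inner (hγ : IsNormalAngleCurve γ) (φ θ : ℝ) :
    (inner ℝ (γ φ) (normalVec θ) : ℝ) ≤ inner ℝ (γ θ) (normalVec θ) := by
  set F : ℝ → ℝ := fun φ => inner ℝ (γ φ) (normalVec θ) with hF
  have hFd : ∀ φ, HasDerivAt F (inner ℝ (deriv γ φ) (normalVec θ)) φ := fun φ => by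
    have h := (hγ.differentiable φ).hasDerivAt.inner ℝ (hasDerivAt_const φ (normalVec θ))
    exact h.congr_deriv (by rw [inner_zero_right, zero_add])
  have hFd' : ∀ φ, ∃ ρ : ℝ, 0 < ρ ∧ deriv F φ = ρ * Real.sin (θ - φ) := fun φ => by
    obtain ⟨ρ, hρ, h⟩ := hγ.normal φ
    refine ⟨ρ, hρ, ?_⟩
    rw [(hFd φ).deriv, h, ← Complex.real_smul, real_inner_smul_left, inner_I_mul_normalVec]
  have hFdiff : Differentiable ℝ F := fun φ => (hFd φ).differentiableAt
  have hpi := Real.pi_pos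
  -- by periodicity, `φ` may be moved to within `π` of `θ`
  obtain ⟨ψ, hψ, hγψ⟩ := hγ.closed.exists_mem_Ico Real.two_pi_pos φ (θ - Real.pi)
  rw [show θ - Real.pi + 2 * Real.pi = θ + Real.pi by ring] at hψ
  rw [hγψ]
  change F ψ ≤ F θ
  rcases le_total ψ θ with h | h
  · have hmono : MonotoneOn F (Set.Icc (θ - Real.pi) θ) := by
      refine monotoneOn_of_deriv_nonneg (convex_Icc _ _) hFdiff.continuous.continuousOn
        hFdiff.differentiableOn fun x hx => ?_
      rw [interior_Icc] at hx
      obtain ⟨ρ, hρ, h⟩ := hFd' x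
      rw [h]
      exact mul_nonneg hρ.le (Real.sin_nonneg_of_nonneg_of_le_pi (by linarith [hx.2])
        (by linarith [hx.1]))
    exact hmono ⟨hψ.1, h⟩ ⟨by linarith, le_rfl⟩ h
  · have hanti : AntitoneOn F (Set.Icc θ (θ + Real.pi)) := by
      refine antitoneOn_of_deriv_nonpos (convex_Icc _ _) hFdiff.continuous.continuousOn
        hFdiff.differentiableOn fun x hx => ?_
      rw [interior_Icc] at hx
      obtain ⟨ρ, hρ, h⟩ := hFd' x
      rw [h]
      exact mul_nonpos_of_nonneg_of_nonpos hρ.le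
        (Real.sin_nonpos_of_nonpos_of_neg_pi_le (by linarith [hx.1]) (by linarith [hx.2]))
    exact hanti ⟨le_rfl, by linarith⟩ ⟨h, hψ.2.le⟩ h

lemma supportFun_eq (hγ : IsNormalAngleCurve γ) (θ : ℝ) :
    supportFun (Set.range γ) θ = inner ℝ (γ θ) (normalVec θ) := by
  refine IsGreatest.csSup_eq ⟨⟨γ θ, ⟨θ, rfl⟩, rfl⟩, ?_⟩
  rintro _ ⟨_, ⟨φ, rfl⟩, rfl⟩
  exact hγ.inner_le_inner φ θ

lemma hasDerivAt_supportFun (hγ : IsNormalAngleCurve γ) (θ : ℝ) :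
    HasDerivAt (supportFun (Set.range γ)) (inner ℝ (γ θ) (Complex.I * normalVec θ)) θ := by
  rw [funext hγ.supportFun_eq]
  have h := (hγ.differentiable θ).hasDerivAt.inner ℝ (hasDerivAt_normalVec θ)
  refine h.congr_deriv ?_
  obtain ⟨ρ, -, h⟩ := hγ.normal θ
  rw [h, ← Complex.real_smul, real_inner_smul_left, inner_I_mul_normalVec]
  simp

lemma isSmoothPeriodic_supportFun (hγ : IsNormalAngleCurve γ) :
    IsSmoothPeriodic (supportFun (Set.range γ)) where
  smooth := by
    rw [funext hγ.supportFun_eq]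
    refine hγ.smooth.inner ℝ ?_
    unfold normalVec
    exact Complex.contDiff_exp.comp (Complex.ofRealCLM.contDiff.mul contDiff_const)
  periodic θ := by
    rw [hγ.supportFun_eq, hγ.supportFun_eq, hγ.closed θ, normalVec_periodic θ]

lemma curveOfSupport_supportFun (hγ : IsNormalAngleCurve γ) :
    curveOfSupport (supportFun (Set.range γ)) = γ := by
  ext θ
  rw [curveOfSupport, (hγ.hasDerivAt_supportFun θ).deriv, hγ.supportFun_eq, Complex.inner,
    Complex.inner]
  have hunit := normSq_normalVec θ
  generalize normalVec θ = e at hunit ⊢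
  rw [Complex.normSq_apply] at hunit
  apply Complex.ext
  · simp
    linear_combination (γ θ).re * hunit
  · simp
    linear_combination (γ θ).im * hunit

/-- The radius of curvature of a curve with support function `h` is `h + h''`. -/
lemma deriv_eq (hγ : IsNormalAngleCurve γ) (θ : ℝ) :
    deriv γ θ = ((supportFun (Set.range γ) θ
      + deriv (deriv (supportFun (Set.range γ))) θ : ℝ) : ℂ) * (Complex.I * normalVec θ) := by
  have h := (hasDerivAt_supportCurve hγ.isSmoothPeriodic_supportFun 0 θ).deriv
  rw [← curveOfSupport_eq, hγ.curveOfSupport_supportFun] at h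
  simpa using h

lemma add_deriv_deriv_pos (hγ : IsNormalAngleCurve γ) (θ : ℝ) :
    0 < supportFun (Set.range γ) θ + deriv (deriv (supportFun (Set.range γ))) θ := by
  obtain ⟨ρ, hρ, h⟩ := hγ.normal θ
  have hne : Complex.I * normalVec θ ≠ 0 := mul_ne_zero Complex.I_ne_zero (Complex.exp_ne_zero _)
  rw [hγ.deriv_eq] at h
  have := mul_right_cancel₀ hne h
  rw [Complex.ofReal_inj.mp this]
  exact hρ

end IsNormalAngleCurve

/-! ### Characterisation of circles -/

lemma range_add_mul_normalVec (c : ℂ) {R : ℝ} (hR : 0 ≤ R) :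
    Set.range (fun θ => c + R * normalVec θ) = Metric.sphere c R := by
  have := range_circleMap c R
  rw [abs_of_nonneg hR] at this
  exact this

lemma supportFun_sphere (c : ℂ) {R : ℝ} (hR : 0 ≤ R) (θ : ℝ) :
    supportFun (Metric.sphere c R) θ = c.re * Real.cos θ + c.im * Real.sin θ + R := by
  have hn : ‖normalVec θ‖ = 1 := Complex.norm_exp_ofReal_mul_I θ
  have hself : (inner ℝ ((R : ℂ) * normalVec θ) (normalVec θ) : ℝ) = R := by
    rw [← Complex.real_smul, real_inner_smul_left, real_inner_self_eq_norm_sq, hn]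
    simp
  refine IsGreatest.csSup_eq ⟨⟨c + R * normalVec θ, ?_, ?_⟩, ?_⟩
  · rw [← range_add_mul_normalVec c hR]
    exact ⟨θ, rfl⟩
  · simp only [inner_add_left, hself, inner_normalVec]
  · rintro _ ⟨z, hz, rfl⟩
    have h1 : (inner ℝ (z - c) (normalVec θ) : ℝ) ≤ R := by
      refine (real_inner_le_norm _ _).trans ?_
      rw [hn, mul_one, ← mem_sphere_iff_norm.mp hz]
    rw [inner_sub_left, inner_normalVec c] at h1
    linarith

/-- The trace is a circle if and only if the Fourier coefficients of the support function vanish for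
all indices other than `0` and `± 1`, since this says that the radius of curvature is constant. -/
lemma IsNormalAngleCurve.isCircle_iff {γ : ℝ → ℂ} (hγ : IsNormalAngleCurve γ) :
    IsCircle γ ↔ ∀ n : ℤ, 2 ≤ |n| → coeff (supportFun (Set.range γ)) n = 0 := by
  have hs := hγ.isSmoothPeriodic_supportFun
  have hsum := hs.add hs.deriv.deriv
  have hcoeff : ∀ n : ℤ, coeff (deriv fun θ => supportFun (Set.range γ) θ
      + deriv (deriv (supportFun (Set.range γ))) θ) n
      = n * Complex.I * (1 - (n : ℂ) ^ 2) * coeff (supportFun (Set.range γ)) n := fun n => by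
    rw [coeff_deriv hsum, coeff_add_deriv_deriv hs]
    push_cast; ring
  constructor
  · rintro ⟨c, R, hR, hrange⟩ n hn
    have hsf : supportFun (Set.range γ)
        = fun θ => c.re * Real.cos θ + c.im * Real.sin θ + R := by
      rw [hrange]; exact funext (supportFun_sphere c hR.le)
    have hd1 : deriv (supportFun (Set.range γ))
        = fun θ => -c.re * Real.sin θ + c.im * Real.cos θ := by
      ext θ
      rw [hsf]
      have h := (((Real.hasDerivAt_cos θ).const_mul c.re).add
        ((Real.hasDerivAt_sin θ).const_mul c.im)).add_const R
      exact h.deriv.trans (by ring)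
    have hd2 : deriv (deriv (supportFun (Set.range γ)))
        = fun θ => -c.re * Real.cos θ - c.im * Real.sin θ := by
      ext θ
      rw [hd1]
      have h := ((Real.hasDerivAt_sin θ).const_mul (-c.re)).add
        ((Real.hasDerivAt_cos θ).const_mul c.im)
      exact h.deriv.trans (by ring)
    have hconst : (fun θ => supportFun (Set.range γ) θ
        + deriv (deriv (supportFun (Set.range γ))) θ) = fun _ => R := by
      rw [hd2, hsf]; ext θ; ring
    have h := hcoeff n
    rw [hconst] at h
    have h0 : coeff (deriv fun _ : ℝ => R) n = 0 := by simp [coeff]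
    rw [h0, eq_comm] at h
    have hn0 : (n : ℂ) ≠ 0 := by
      have : n ≠ 0 := by rintro rfl; simp at hn
      exact_mod_cast this
    have hn1 : (1 - (n : ℂ) ^ 2) ≠ 0 := by
      have : (1 - n ^ 2 : ℤ) ≠ 0 := by
        have := sq_abs n
        nlinarith
      exact_mod_cast this
    exact (mul_eq_zero.mp h).resolve_left (mul_ne_zero (mul_ne_zero hn0 Complex.I_ne_zero) hn1)
  · intro h
    set ρ : ℝ → ℝ := fun θ => supportFun (Set.range γ) θ
      + deriv (deriv (supportFun (Set.range γ))) θ with hρ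
    have hd0 : ∀ θ, deriv ρ θ = 0 :=
      eq_zero_of_coeff_eq_zero hsum.deriv.continuous hsum.deriv.periodic fun n => by
        rw [hcoeff]
        rcases le_or_gt 2 |n| with hn | hn
        · rw [h n hn, mul_zero]
        · have : n = 0 ∨ n = 1 ∨ n = -1 := by rw [abs_lt] at hn; omega
          rcases this with rfl | rfl | rfl <;> simp
    have hconst : ∀ θ, ρ θ = ρ 0 := fun θ =>
      is_const_of_deriv_eq_zero (hsum.smooth.differentiable (by simp)) hd0 θ 0
    have hγd : ∀ θ, HasDerivAt (fun θ => γ θ - ρ 0 * normalVec θ) 0 θ := fun θ => by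
      have h1 := (hγ.differentiable θ).hasDerivAt.sub
        ((hasDerivAt_normalVec θ).const_mul ((ρ 0 : ℝ) : ℂ))
      refine h1.congr_deriv ?_
      rw [hγ.deriv_eq, ← hconst θ, sub_self]
    -- `γ - R n` is constant, and this constant is the center
    have hγc : ∀ θ, γ θ - ρ 0 * normalVec θ = γ 0 - ρ 0 * normalVec 0 := fun θ =>
      is_const_of_deriv_eq_zero (fun x => (hγd x).differentiableAt) (fun x => (hγd x).deriv) θ 0
    refine ⟨γ 0 - ρ 0 * normalVec 0, ρ 0, hγ.add_deriv_deriv_pos 0, ?_⟩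
    rw [← range_add_mul_normalVec _ (hγ.add_deriv_deriv_pos 0).le]
    congr 1
    ext θ
    rw [← hγc θ]; ring

/-! ### The spectral weights -/

/-- The binomial expansion of `(x - τ)^m`, grouped by the parity of the exponent of `τ`, when the
positive powers of `τ` are `τ` or `τ²` because `τ ∈ {0, 1, -1}`. -/
lemma sub_pow_eq_sum_filter_parity {τ : ℝ} (hτ : τ = 0 ∨ τ = 1 ∨ τ = -1) (x : ℝ) {m : ℕ}
    (hm : 1 ≤ m) :
    (x - τ) ^ m = x ^ m + (∑ j ∈ (Finset.Icc 1 (m - 1)).filter Even,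
        (m.choose j : ℝ) * (x ^ (m - j) * τ ^ 2))
      - (∑ j ∈ (Finset.Icc 1 (m - 1)).filter Odd, (m.choose j : ℝ) * (x ^ (m - j) * τ))
      + (-τ) ^ m := by
  have heven : ∀ j, 1 ≤ j → Even j → (-τ) ^ j = τ ^ 2 := fun j hj he => by
    rw [he.neg_pow]
    rcases hτ with rfl | rfl | rfl
    · rw [zero_pow (by omega), zero_pow two_ne_zero]
    · simp
    · simp [he.neg_one_pow]
  have hodd : ∀ j, Odd j → (-τ) ^ j = -τ := fun j ho => by
    rw [ho.neg_pow]
    rcases hτ with rfl | rfl | rfl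
    · rw [zero_pow ho.pos.ne']
    · simp
    · simp [ho.neg_one_pow]
  have hsplit : ∑ j ∈ Finset.Icc 1 (m - 1), (m.choose j : ℝ) * (x ^ (m - j) * (-τ) ^ j)
      = (∑ j ∈ (Finset.Icc 1 (m - 1)).filter Even, (m.choose j : ℝ) * (x ^ (m - j) * τ ^ 2))
      - ∑ j ∈ (Finset.Icc 1 (m - 1)).filter Odd, (m.choose j : ℝ) * (x ^ (m - j) * τ) := by
    rw [← Finset.sum_filter_add_sum_filter_not _ Even, sub_eq_add_neg, ← Finset.sum_neg_distrib]
    simp only [Nat.not_even_iff_odd]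
    congr 1
    · refine Finset.sum_congr rfl fun j hj => ?_
      rw [Finset.mem_filter, Finset.mem_Icc] at hj
      rw [heven j hj.1.1 hj.2]
    · refine Finset.sum_congr rfl fun j hj => ?_
      rw [hodd j (Finset.mem_filter.mp hj).2]
      ring
  obtain ⟨q, rfl⟩ : ∃ q, m = q + 1 := ⟨m - 1, by omega⟩
  rw [add_sub_assoc, ← hsplit, show x - τ = -τ + x by ring, add_pow, Finset.sum_range_succ,
    Finset.sum_range_succ', Nat.add_sub_cancel, Finset.range_eq_Ico,
    Finset.sum_Ico_add' (fun j : ℕ => (-τ) ^ j * x ^ (q + 1 - j) * ((q + 1).choose j : ℝ)) 0 q 1,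
    zero_add, Finset.Ico_add_one_right_eq_Icc]
  simp only [pow_zero, one_mul, Nat.sub_zero, Nat.choose_zero_right, Nat.cast_one, mul_one,
    Nat.sub_self, Nat.choose_self]
  rw [add_comm (Finset.sum _ _)]
  congr 2
  exact Finset.sum_congr rfl fun j _ => by ring

/-- The weight with which `|a_n|²`, where `a_n` is the `n`-th Fourier coefficient of the support
function, enters the deficit of the inequality of order `m`. -/
noncomputable def weight (k m : ℕ) (n : ℤ) : ℝ :=
  Real.pi * ((n : ℝ) ^ 2 - 1 + multiplier k n) ^ m

lemma weight_eq_zero {k m : ℕ} (hk : 2 ≤ k) (hm : 1 ≤ m) {n : ℤ} (hn : |n| < 2) :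
    weight k m n = 0 := by
  have hn' : n = 0 ∨ n = 1 ∨ n = -1 := by rw [abs_lt] at hn; omega
  have hbase : (n : ℝ) ^ 2 - 1 + multiplier k n = 0 := by
    have h1 : ¬ (k : ℤ) ∣ 1 := fun h => by
      have := Int.le_of_dvd one_pos h
      omega
    rcases hn' with rfl | rfl | rfl
    · simp [multiplier]
    · simp [multiplier_of_not_dvd h1]
    · simp [multiplier_of_not_dvd (fun h => h1 ((dvd_neg).mp h) : ¬ (k : ℤ) ∣ -1)]
  rw [weight, hbase, zero_pow (by omega), mul_zero]

lemma weight_pos (k m : ℕ) {n : ℤ} (hn : 2 ≤ |n|) : 0 < weight k m n := by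
  have h4 : (4 : ℝ) ≤ (n : ℝ) ^ 2 := by
    have : (4 : ℤ) ≤ n ^ 2 := by rw [← sq_abs]; nlinarith
    exact_mod_cast this
  have hbase : 0 < (n : ℝ) ^ 2 - 1 + multiplier k n := by
    rcases multiplier_eq_or k n with h | h | h <;> rw [h] <;> linarith
  exact mul_pos Real.pi_pos (pow_pos hbase m)

lemma weight_nonneg {k m : ℕ} (hk : 2 ≤ k) (hm : 1 ≤ m) (n : ℤ) : 0 ≤ weight k m n := by
  rcases lt_or_ge |n| 2 with hn | hn
  · exact (weight_eq_zero hk hm hn).ge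
  · exact (weight_pos k m hn).le

section Expressions

variable {γ : ℝ → ℂ} {k m : ℕ}

lemma hasSum_areaSum (hγ : IsNormalAngleCurve γ) (hm : 1 ≤ m) :
    HasSum (fun n : ℤ => Real.pi * (1 - (n : ℝ) ^ 2) ^ m *
      Complex.normSq (coeff (supportFun (Set.range γ)) n)) (areaSum m γ) := by
  have hs := hγ.isSmoothPeriodic_supportFun
  have h := hasSum_mixedSum hs hs (show 0 < m from hm)
  rw [hγ.curveOfSupport_supportFun, ← areaSum_eq_mixedSum] at h
  refine hasSum_of_eq h (fun n => ?_) rfl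
  rw [← Complex.normSq_eq_conj_mul_self, Complex.ofReal_re, Nat.sub_zero]

lemma hasSum_mixedSum_iterTCurve (hγ : IsNormalAngleCurve γ) (hk : 0 < k) {j : ℕ} (hj : j < m)
    (i : ℕ) :
    HasSum (fun n : ℤ => Real.pi * (1 - (n : ℝ) ^ 2) ^ (m - j) * multiplier k n ^ i *
      Complex.normSq (coeff (supportFun (Set.range γ)) n)) (mixedSum m j γ (iterTCurve k i γ)) := by
  have hs := hγ.isSmoothPeriodic_supportFun
  have h := hasSum_mixedSum hs (hs.iterate_T k i) hj
  rw [hγ.curveOfSupport_supportFun] at h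
  refine hasSum_of_eq h (fun n => ?_) rfl
  rw [coeff_iterate_T hs hk, mul_left_comm, ← Complex.normSq_eq_conj_mul_self,
    Complex.re_ofReal_mul, Complex.ofReal_re]
  ring

lemma hasSum_sum_filter_mixedSum (hγ : IsNormalAngleCurve γ) (hk : 0 < k) (hm : 1 ≤ m)
    (p : ℕ → Prop) [DecidablePred p] (i : ℕ) :
    HasSum (fun n : ℤ => Real.pi * (∑ j ∈ (Finset.Icc 1 (m - 1)).filter p,
        (m.choose j : ℝ) * ((1 - (n : ℝ) ^ 2) ^ (m - j) * multiplier k n ^ i)) *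
      Complex.normSq (coeff (supportFun (Set.range γ)) n))
      (∑ j ∈ (Finset.Icc 1 (m - 1)).filter p,
        (m.choose j : ℝ) * mixedSum m j γ (iterTCurve k i γ)) := by
  refine hasSum_of_eq (hasSum_sum fun j hj => (hasSum_mixedSum_iterTCurve hγ hk (m := m)
    (j := j) ?_ i).mul_left (m.choose j : ℝ)) (fun n => ?_) rfl
  · rw [Finset.mem_filter, Finset.mem_Icc] at hj
    omega
  · rw [Finset.mul_sum, Finset.sum_mul]
    exact Finset.sum_congr rfl fun j _ => by ring

/-- With `x = 1 - n²` and `τ` the multiplier, the terms of the expression add up to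
`-(x - τ)^m = (n² - 1 + τ)^m`; the width integral is the summand `j = m` of the binomial
expansion. -/
lemma hasSum_oddExpr (hγ : IsNormalAngleCurve γ) (hk : 0 < k) (hm : Odd m) :
    HasSum (fun n : ℤ => weight k m n * Complex.normSq (coeff (supportFun (Set.range γ)) n))
      (oddExpr k m γ) := by
  have hs := hγ.isSmoothPeriodic_supportFun
  refine hasSum_of_eq ((((hasSum_areaSum hγ hm.pos).neg.add
    (hasSum_integral_genWidth_mul_shift hs hk)).sub
    (hasSum_sum_filter_mixedSum hγ hk hm.pos Even 2)).add
    (hasSum_sum_filter_mixedSum hγ hk hm.pos Odd 1)) (fun n => ?_) rfl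
  have hτ := multiplier_eq_or k n
  have key := sub_pow_eq_sum_filter_parity hτ (1 - (n : ℝ) ^ 2) hm.pos
  have hlast : (-multiplier k n) ^ m = -multiplier k n := by
    rw [hm.neg_pow]
    rcases hτ with h | h | h <;> simp [h, hm.neg_one_pow, hm.pos.ne']
  rw [hlast, ← neg_sub, hm.neg_pow] at key
  simp only [pow_one]
  rw [weight, show (n : ℝ) ^ 2 - 1 + multiplier k n = multiplier k n - (1 - (n : ℝ) ^ 2) by ring]
  linear_combination
    -(Real.pi * Complex.normSq (coeff (supportFun (Set.range γ)) n)) * key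

/-- As for odd `m`, but now the summand `j = m` is `τ²`, which is why the width integral contains
`w_k²`, and the terms add up to `(x - τ)^m`. -/
lemma hasSum_evenExpr (hγ : IsNormalAngleCurve γ) (hk : 0 < k) (hm1 : 1 ≤ m) (hm : Even m) :
    HasSum (fun n : ℤ => weight k m n * Complex.normSq (coeff (supportFun (Set.range γ)) n))
      (evenExpr k m γ) := by
  have hs := hγ.isSmoothPeriodic_supportFun
  refine hasSum_of_eq ((((hasSum_areaSum hγ hm1).add
    (hasSum_integral_genWidth_sq hs hk)).add
    (hasSum_sum_filter_mixedSum hγ hk hm1 Even 2)).sub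
    (hasSum_sum_filter_mixedSum hγ hk hm1 Odd 1)) (fun n => ?_) rfl
  have hτ := multiplier_eq_or k n
  have key := sub_pow_eq_sum_filter_parity hτ (1 - (n : ℝ) ^ 2) hm1
  have hlast : (-multiplier k n) ^ m = multiplier k n ^ 2 := by
    rw [hm.neg_pow]
    rcases hτ with h | h | h <;> simp [h, hm.neg_one_pow, (show m ≠ 0 by omega)]
  rw [hlast, ← neg_sub, hm.neg_pow] at key
  simp only [pow_one]
  rw [weight, show (n : ℝ) ^ 2 - 1 + multiplier k n = multiplier k n - (1 - (n : ℝ) ^ 2) by ring]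
  linear_combination
    (Real.pi * Complex.normSq (coeff (supportFun (Set.range γ)) n)) * key

/-- The weights are nonnegative, and positive exactly for `|n| ≥ 2`; so the deficit is nonnegative
and vanishes only when the support function has no Fourier modes of index `|n| ≥ 2`. -/
lemma nonneg_and_eq_zero_iff_isCircle (hγ : IsNormalAngleCurve γ) (hk : 2 ≤ k) (hm : 1 ≤ m)
    {E : ℝ} (hE : HasSum (fun n : ℤ => weight k m n *
      Complex.normSq (coeff (supportFun (Set.range γ)) n)) E) :
    0 ≤ E ∧ (E = 0 ↔ IsCircle γ) := by
  have hnonneg : ∀ n : ℤ, 0 ≤ weight k m n *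
      Complex.normSq (coeff (supportFun (Set.range γ)) n) := fun n =>
    mul_nonneg (weight_nonneg hk hm n) (Complex.normSq_nonneg _)
  refine ⟨hE.nonneg hnonneg, ?_⟩
  rw [hγ.isCircle_iff]
  constructor
  · rintro rfl n hn
    have h := congr_fun ((hasSum_zero_iff_of_nonneg hnonneg).mp hE) n
    exact Complex.normSq_eq_zero.mp ((mul_eq_zero.mp h).resolve_left (weight_pos k m hn).ne')
  · intro h
    refine hE.unique ?_
    convert (hasSum_zero : HasSum (fun _ : ℤ => (0 : ℝ)) 0) using 2 with n
    rcases lt_or_ge |n| 2 with hn | hn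
    · rw [weight_eq_zero hk hm hn, zero_mul]
    · rw [h n hn, map_zero, mul_zero]

lemma oddExpr_one (k : ℕ) (γ : ℝ → ℂ) :
    oddExpr k 1 γ = (1 / (k : ℝ)) * (∫ θ in (0 : ℝ)..(Real.pi / k),
      genWidth k (supportFun (Set.range γ)) θ *
        genWidth k (supportFun (Set.range γ)) (θ + Real.pi / k)) - algArea γ := by
  simp [oddExpr, areaSum, iterLocus]
  ring

lemma genWidth_two (h : ℝ → ℝ) (θ : ℝ) : genWidth 2 h θ = h θ + h (θ + Real.pi) := by
  simp [genWidth, Finset.sum_range_succ]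

end Expressions

/-- The inequality of Ou and Pan. -/
lemma algArea_le_and_eq_iff_isCircle {γ : ℝ → ℂ} (hγ : IsNormalAngleCurve γ) {k : ℕ}
    (hk : 2 ≤ k) :
    algArea γ ≤ (1 / (k : ℝ)) * (∫ θ in (0 : ℝ)..(Real.pi / k),
        genWidth k (supportFun (Set.range γ)) θ *
          genWidth k (supportFun (Set.range γ)) (θ + Real.pi / k)) ∧
    (algArea γ = (1 / (k : ℝ)) * (∫ θ in (0 : ℝ)..(Real.pi / k),
        genWidth k (supportFun (Set.range γ)) θ *
          genWidth k (supportFun (Set.range γ)) (θ + Real.pi / k)) ↔ IsCircle γ) := by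
  have h := nonneg_and_eq_zero_iff_isCircle hγ hk le_rfl
    (hasSum_oddExpr hγ (by omega) (m := 1) odd_one)
  rw [oddExpr_one, sub_nonneg, sub_eq_zero] at h
  exact ⟨h.1, eq_comm.trans h.2⟩

end Chernoff

theorem mainTheorem3 (γ : ℝ → ℂ) (hγ : Chernoff.IsNormalAngleCurve γ) :
    -- the higher order inequalities
    (∀ k m : ℕ, 2 ≤ k → 1 ≤ m →
      (Odd m → 0 ≤ Chernoff.oddExpr k m γ ∧
        (Chernoff.oddExpr k m γ = 0 ↔ Chernoff.IsCircle γ)) ∧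
      (Even m → 0 ≤ Chernoff.evenExpr k m γ ∧
        (Chernoff.evenExpr k m γ = 0 ↔ Chernoff.IsCircle γ))) ∧
    -- the case m = 1
    (∀ k : ℕ, 2 ≤ k →
      Chernoff.algArea γ ≤ (1 / (k : ℝ)) * (∫ θ in (0 : ℝ)..(Real.pi / k),
          Chernoff.genWidth k (Chernoff.supportFun (Set.range γ)) θ *
            Chernoff.genWidth k (Chernoff.supportFun (Set.range γ)) (θ + Real.pi / k)) ∧
      (Chernoff.algArea γ = (1 / (k : ℝ)) * (∫ θ in (0 : ℝ)..(Real.pi / k),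
          Chernoff.genWidth k (Chernoff.supportFun (Set.range γ)) θ *
            Chernoff.genWidth k (Chernoff.supportFun (Set.range γ)) (θ + Real.pi / k)) ↔
        Chernoff.IsCircle γ)) ∧
    -- the case m = 1, k = 2, with the ordinary width w(θ) = h(θ) + h(θ + π)
    (∀ w : ℝ → ℝ,
      (∀ θ, w θ = Chernoff.supportFun (Set.range γ) θ
        + Chernoff.supportFun (Set.range γ) (θ + Real.pi)) →
      Chernoff.algArea γ ≤ (1 / 2) * (∫ θ in (0 : ℝ)..(Real.pi / 2),
          w θ * w (θ + Real.pi / 2)) ∧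
      (Chernoff.algArea γ = (1 / 2) * (∫ θ in (0 : ℝ)..(Real.pi / 2),
          w θ * w (θ + Real.pi / 2)) ↔
        Chernoff.IsCircle γ)) := by
  refine ⟨fun k m hk hm => ⟨fun hodd => ?_, fun heven => ?_⟩,
    fun k hk => Chernoff.algArea_le_and_eq_iff_isCircle hγ hk, fun w hw => ?_⟩
  · exact Chernoff.nonneg_and_eq_zero_iff_isCircle hγ hk hm
      (Chernoff.hasSum_oddExpr hγ (by omega) hodd)
  · exact Chernoff.nonneg_and_eq_zero_iff_isCircle hγ hk hm
      (Chernoff.hasSum_evenExpr hγ (by omega) hm heven)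
  · obtain rfl : w = Chernoff.genWidth 2 (Chernoff.supportFun (Set.range γ)) :=
      funext fun θ => (hw θ).trans (Chernoff.genWidth_two _ θ).symm
    exact_mod_cast Chernoff.algArea_le_and_eq_iff_isCircle hγ le_rfl
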